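/- Let $\mathbf E\subset\mathbb R^d$ be compact and convex with non-empty interior, with Borel $\sigma$-algebra $\mathcal E$; let $\mathbf K$ be the family of compact subsets of $\mathbf E$ with the Borel $\sigma$-algebra of the Hausdorff metric, and let $\mathbf M$ be the set of measures $m$ on $\mathcal E$ with $m(A)\in\mathbb N=\{0,1,2,\dots\}$ for all $A\in\mathcal E$, with the $\sigma$-algebra generated by the maps $m\mapsto m(A)$, $A\in\mathcal E$. Write $|A|$ for Lebesgue measure. For a Borel set $B\subseteq\mathbf E$ and $\lambda>0$, a random element $\mathcal N$ of $\mathbf M$ is called a Poisson point process of intensity $\lambda$ on $B$ if $\mathcal N(A)\sim\mathrm{Poiss}(\lambda|A\cap B|)$ for all $A\in\mathcal E$, and $\mathcal N(A_1),\dots,\mathcal N(A_n)$ are independent for all pairwise disjoint $A_1,\dots,A_n\in\mathcal E$. Let $C\subseteq\mathbf E$ be closed and convex, $\lambda>0$, and let $\mathcal N$ be a Poisson point process of intensity $\lambda$ on $C$, defined on a probability space $(\Omega,\mathcal F,\mathbb P)$. Put $\mathcal F_K=\sigma(\mathcal N(U):U\subseteq K,\ U\in\mathbf K)$ for $K\in\mathbf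 K$, and $\mathfrak F=\sigma(\mathcal F_K:K\in\mathbf K)$. Let $\mathcal K$ be a stopping set, that is, a measurable map $\mathcal K:\mathbf M\to\mathbf K$, evaluated at $\mathcal N$, such that $\{\mathcal K\subseteq K\}\in\mathcal F_K$ for all $K\in\mathbf K$; let $\mathcal F_{\mathcal K}=\{A\in\mathfrak F: A\cap\{\mathcal K\subseteq K\}\in\mathcal F_K\ \ \forall K\in\mathbf K\}$ be its history. Then $\mathcal N$ is strong Markov at $\mathcal K$ in the following sense: the point process $\mathcal N_{\mathcal K^c}:A\mapsto\mathcal N(A\setminus\mathcal K)$ is a measurable map $\Omega\to\mathbf M$ and, conditionally on $\mathcal F_{\mathcal K}$, it is a Poisson point process of intensity $\lambda$ on $C\setminus\mathcal K$ (on $\mathcal K^c$ if $C=\mathbf E$). That is, it has a regular conditional distribution $\kappa$ given $\mathcal F_{\mathcal K}$ such that, for every $\omega\in\Omega$, $\kappa(\omega,\cdot)$ is the law of a Poisson point process of intensity $\lambda$ on $C\setminus\mathcal K(\mathcal N(\omega))$. In particular, for all $K\in\mathbf K$, $$\mathcal N(K\setminus\mathcal K)\,\big|\,\mathcal F_{\mathcal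 K}\sim\mathrm{Poiss}\bigl(\lambda\,|(K\cap C)\setminus\mathcal K|\bigr),$$ which is $\mathrm{Poiss}(\lambda|K\setminus\mathcal K|)$ if $C=\mathbf E$. -/

import Mathlib

open MeasureTheory ProbabilityTheory TopologicalSpace
open scoped NNReal ENNReal

/-- The space `M` of point measures on `X`: measures with values in `ℕ` on all measurable sets. -/
def PointMeasure (X : Type*) [MeasurableSpace X] : Type _ :=
  {m : Measure X // ∀ A : Set X, MeasurableSet A → ∃ n : ℕ, m A = n}

/-- The σ-algebra on point measures generated by the evaluations `m ↦ m A`, `A` measurable. -/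
instance PointMeasure.instMeasurableSpace (X : Type*) [MeasurableSpace X] :
    MeasurableSpace (PointMeasure X) :=
  ⨆ (A : Set X) (_ : MeasurableSet A),
    MeasurableSpace.comap (fun m : PointMeasure X => m.1 A) inferInstance

/-- The point measure `A ↦ m (A \ K)`, for `K` compact. -/
noncomputable def PointMeasure.restrictCompl {X : Type*} [TopologicalSpace X] [T2Space X]
    [MeasurableSpace X] [BorelSpace X] (m : PointMeasure X) (K : Compacts X) : PointMeasure X :=
  ⟨m.1.restrict (K : Set X)ᶜ, fun A hA => by
    rw [Measure.restrict_apply hA]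
    exact m.2 _ (hA.inter K.isCompact.measurableSet.compl)⟩

/-- Lebesgue measure on the subset `E` of `ℝ^d`, as a measure on the subtype. -/
noncomputable def lebesgueOn {d : ℕ} (E : Set (EuclideanSpace ℝ (Fin d))) : Measure E :=
  Measure.comap (fun x : E => (x : EuclideanSpace ℝ (Fin d))) volume

/-- `N` is, under `P`, a Poisson point process of intensity `lam` on the subset `C` of the state
space `E`: for Borel `A`, the number of points in `A` is Poisson with mean `lam * |A ∩ C|`,
and the numbers of points in disjoint Borel sets are independent. The state space is
bounded in all uses, so that the mean is finite. -/
structure IsPoissonPointProcess {d : ℕ} {E : Set (EuclideanSpace ℝ (Fin d))}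
    {Ω : Type*} [MeasurableSpace Ω]
    (P : Measure Ω) (N : Ω → PointMeasure E) (lam : ℝ≥0) (C : Set E) : Prop where
  measurable : Measurable N
  law : ∀ A : Set E, MeasurableSet A →
    HasLaw (fun ω => (N ω).1 A)
      ((poissonMeasure (lam * (lebesgueOn E (A ∩ C)).toNNReal)).map (Nat.cast : ℕ → ℝ≥0∞)) P
  indep : ∀ (n : ℕ) (A : Fin n → Set E), (∀ i, MeasurableSet (A i)) →
    Pairwise (fun i j => Disjoint (A i) (A j)) →
    iIndepFun (fun (i : Fin n) (ω : Ω) => (N ω).1 (A i)) P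

section Filtration

variable {Ω X : Type*} [TopologicalSpace X] [MeasurableSpace X]

/-- The natural set-indexed filtration `F_K = σ(N(U) : U ⊆ K, U compact)`. -/
@[reducible] def setFiltration (N : Ω → PointMeasure X) (K : Compacts X) : MeasurableSpace Ω :=
  ⨆ (U : Compacts X) (_ : (U : Set X) ⊆ K),
    MeasurableSpace.comap (fun ω => (N ω).1 U) inferInstance

/-- A random compact set `𝒦`, that is a map from point measures to compact sets which is measurable
for the Borel σ-algebra of the Hausdorff metric, is a stopping set if `{𝒦 ⊆ K} ∈ F_K` for all
compact `K`. -/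
structure IsStoppingSet (N : Ω → PointMeasure X) (𝒦 : PointMeasure X → Compacts X) : Prop where
  measurable : Measurable[PointMeasure.instMeasurableSpace X, borel (Compacts X)] 𝒦
  measurableSet_subset : ∀ K : Compacts X,
    MeasurableSet[setFiltration N K] {ω | (𝒦 (N ω) : Set X) ⊆ K}

/-- The σ-algebra of `𝒦`-history: the events `A` of `σ(F_K : K compact)` such that
`A ∩ {𝒦 ⊆ K} ∈ F_K` for all compact `K`. -/
@[reducible] def IsStoppingSet.history {N : Ω → PointMeasure X} {𝒦 : PointMeasure X → Compacts X}
    (h : IsStoppingSet N 𝒦) : MeasurableSpace Ω where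
  MeasurableSet' A := MeasurableSet[⨆ K, setFiltration N K] A ∧
    ∀ K : Compacts X, MeasurableSet[setFiltration N K] (A ∩ {ω | (𝒦 (N ω) : Set X) ⊆ K})
  measurableSet_empty := by
    refine ⟨@MeasurableSet.empty _ (_), fun K => ?_⟩
    rw [Set.empty_inter]
    exact @MeasurableSet.empty _ (_)
  measurableSet_compl A hA := by
    refine ⟨@MeasurableSet.compl _ _ (_) hA.1, fun K => ?_⟩
    have hK := @MeasurableSet.diff _ (setFiltration N K) _ _ (h.measurableSet_subset K) (hA.2 K)
    convert hK using 1
    ext ω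
    simp only [Set.mem_inter_iff, Set.mem_compl_iff, Set.mem_sdiff]
    tauto
  measurableSet_iUnion f hf := by
    refine ⟨@MeasurableSet.iUnion _ _ (_) _ _ fun i => (hf i).1, fun K => ?_⟩
    rw [Set.iUnion_inter]
    exact @MeasurableSet.iUnion _ _ (setFiltration N K) _ _ fun i => (hf i).2 K

end Filtration

/-! Cover `E` by finitely many closed balls of radius `1 / (n + 1)` and let `𝒦ₙ` be the union of
those that meet `𝒦`. This set contains `𝒦`, takes finitely many values and converges pointwise to
`𝒦`. If `T` is the set of centres of the balls that are hit, then a history event intersected with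
`{netHits = T}` depends only on the points inside `ballUnion n T`
(`measurableSet_inter_netHits_eq`), hence is independent of the points outside
(`HasIndepCounts.indep_restrictCompl`). Summing over `T` shows that, on a history event, the process
outside `𝒦ₙ` behaves like an independent copy outside `𝒦ₙ` (`HasIndepCounts.measure_inter_netHits`).

Counts are integers, so as `n → ∞` finitely many of them are eventually equal to their limits;
cylinder events pass to the limit, and a π-λ argument gives the identity for `𝒦`
(`HasIndepCounts.measure_inter_restrictCompl`). The conditional law is therefore that of an
independent copy of `N` with the fixed compact set `𝒦 (N ω)` removed, which is Poisson by
`IsPoissonPointProcess.map_restrictCompl`. -/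

open Set Filter Topology

/-! ### Point measures and cylinder events -/

namespace PointMeasure

variable {X : Type*} [MeasurableSpace X]

lemma measurable_apply {A : Set X} (hA : MeasurableSet A) :
    Measurable (fun m : PointMeasure X => m.1 A) :=
  Measurable.of_comap_le (le_iSup₂_of_le A hA le_rfl)

lemma measurable_of_apply {α : Type*} {mα : MeasurableSpace α} {f : α → PointMeasure X}
    (h : ∀ A, MeasurableSet A → Measurable (fun a => (f a).1 A)) : Measurable f := by
  rw [measurable_iff_comap_le, instMeasurableSpace]
  simp only [MeasurableSpace.comap_iSup, MeasurableSpace.comap_comp]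
  exact iSup₂_le fun A hA => measurable_iff_comap_le.1 (h A hA)

instance isFiniteMeasure (m : PointMeasure X) : IsFiniteMeasure m.1 where
  measure_univ_lt_top := by
    obtain ⟨n, hn⟩ := m.2 univ MeasurableSet.univ
    rw [hn]
    exact ENNReal.natCast_lt_top n

/-- Convergence of the number of points means that it is eventually constant. -/
lemma eventually_apply_eq {ι : Type*} {l : Filter ι} {m : ι → PointMeasure X}
    {m' : PointMeasure X} {A : Set X} (hA : MeasurableSet A)
    (h : Tendsto (fun i => (m i).1 A) l (𝓝 (m'.1 A))) : ∀ᶠ i in l, (m i).1 A = m'.1 A := by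
  obtain ⟨k, hk⟩ := m'.2 A hA
  choose j hj using fun i => (m i).2 A hA
  simp only [hk, hj] at h ⊢
  have h2 : Tendsto j l (𝓝 k) := by
    rw [← ENNReal.tendsto_toReal_iff (fun _ => ENNReal.natCast_ne_top _)
      (ENNReal.natCast_ne_top _)] at h
    simp only [ENNReal.toReal_natCast] at h
    exact Nat.isClosedEmbedding_coe_real.isInducing.tendsto_nhds_iff.2 h
  rw [nhds_discrete, tendsto_pure] at h2
  filter_upwards [h2] with i hi
  rw [hi]

/-- The events that depend on the numbers of points in finitely many sets. -/
def cylinders (X : Type*) [MeasurableSpace X] : Set (Set (PointMeasure X)) :=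
  piiUnionInter (fun A : {A : Set X // MeasurableSet A} =>
    {s | MeasurableSet[MeasurableSpace.comap (fun m : PointMeasure X => m.1 A) inferInstance] s})
    univ

lemma isPiSystem_cylinders : IsPiSystem (cylinders X) :=
  isPiSystem_piiUnionInter _ (fun _ => @MeasurableSpace.isPiSystem_measurableSet _ (_)) _

lemma generateFrom_cylinders :
    instMeasurableSpace X = MeasurableSpace.generateFrom (cylinders X) := by
  refine Eq.trans ?_ (generateFrom_piiUnionInter_measurableSet _ univ).symm
  simp only [mem_univ, iSup_pos]
  exact iSup_subtype'

/-- A cylinder event reads finitely many integer counts, each eventually constant. This lets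
probabilities of cylinder events pass to the limit without any continuity condition on the event. -/
lemma eventually_mem_cylinder_iff {ι : Type*} {l : Filter ι} {m : ι → PointMeasure X}
    {m' : PointMeasure X}
    (h : ∀ A, MeasurableSet A → Tendsto (fun i => (m i).1 A) l (𝓝 (m'.1 A)))
    {B : Set (PointMeasure X)} (hB : B ∈ cylinders X) : ∀ᶠ i in l, m i ∈ B ↔ m' ∈ B := by
  obtain ⟨t, -, f, hf, rfl⟩ := hB
  have : ∀ᶠ i in l, ∀ A ∈ t, (m i).1 A = m'.1 A :=
    (eventually_all_finset t).2 fun A _ => eventually_apply_eq A.2 (h A A.2)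
  filter_upwards [this] with i hi
  simp only [mem_iInter]
  refine forall₂_congr fun A hA => ?_
  obtain ⟨V, -, hV⟩ := hf A hA
  rw [← hV, mem_preimage, mem_preimage, hi A hA]

lemma restrictCompl_apply {X : Type*} [TopologicalSpace X] [T2Space X] [MeasurableSpace X]
    [BorelSpace X] (m : PointMeasure X) (K : Compacts X) {A : Set X} (hA : MeasurableSet A) :
    (m.restrictCompl K).1 A = m.1 (A \ K) := by
  rw [restrictCompl, Measure.restrict_apply hA, sdiff_eq]

end PointMeasure

/-- The number of points in `A` is determined by those in the cells of a finite partition. -/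
lemma comap_apply_le_iSup {Ω X : Type*} [MeasurableSpace X] {N : Ω → PointMeasure X}
    {ι : Type*} [Finite ι] {D : ι → Set X} (hD : ∀ i, MeasurableSet (D i))
    (hd : Pairwise (fun i j => Disjoint (D i) (D j))) {A : Set X}
    (hA : ∀ x ∈ A, ∃ i, x ∈ D i ∧ D i ⊆ A) :
    MeasurableSpace.comap (fun ω => (N ω).1 A) inferInstance ≤
      ⨆ i, MeasurableSpace.comap (fun ω => (N ω).1 (D i)) inferInstance := by
  have hAeq : A = ⋃ i ∈ {i | D i ⊆ A}, D i := by
    refine Subset.antisymm (fun x hx => ?_) (iUnion₂_subset fun i hi => hi)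
    obtain ⟨i, hxi, hi⟩ := hA x hx
    exact mem_biUnion (show i ∈ {i | D i ⊆ A} from hi) hxi
  have hcount : ∀ ω, (N ω).1 A = ∑' i : {i | D i ⊆ A}, (N ω).1 (D i) := fun ω => by
    conv_lhs => rw [hAeq]
    exact measure_biUnion (to_countable _) (fun i _ j _ hij => hd hij) (fun i _ => hD i)
  simp only [hcount]
  let _ : MeasurableSpace Ω :=
    ⨆ i, MeasurableSpace.comap (fun ω => (N ω).1 (D i)) inferInstance
  exact Measurable.comap_le (Measurable.tsum fun i => Measurable.of_comap_le
    (le_iSup (fun i => MeasurableSpace.comap (fun ω => (N ω).1 (D i)) inferInstance) i.1))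

lemma setFiltration_mono {Ω X : Type*} [TopologicalSpace X] [MeasurableSpace X]
    (N : Ω → PointMeasure X) {K L : Compacts X} (h : (K : Set X) ⊆ L) :
    setFiltration N K ≤ setFiltration N L :=
  iSup₂_le fun U hU => le_iSup₂_of_le U (hU.trans h) le_rfl

/-! ### Independence of the counts inside and outside a set -/

section Independence

variable {Ω X : Type*} [mΩ : MeasurableSpace Ω] [MeasurableSpace X]

/-- The numbers of points in pairwise disjoint sets are independent. -/
def HasIndepCounts (P : Measure Ω) (N : Ω → PointMeasure X) : Prop :=
  ∀ (n : ℕ) (A : Fin n → Set X), (∀ i, MeasurableSet (A i)) →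
    Pairwise (fun i j => Disjoint (A i) (A j)) →
    iIndepFun (fun (i : Fin n) (ω : Ω) => (N ω).1 (A i)) P

variable {P : Measure Ω} {N : Ω → PointMeasure X}

lemma HasIndepCounts.iIndepFun (h : HasIndepCounts P N) {ι : Type*} [Finite ι] (A : ι → Set X)
    (hA : ∀ i, MeasurableSet (A i)) (hd : Pairwise (fun i j => Disjoint (A i) (A j))) :
    iIndepFun (fun i ω => (N ω).1 (A i)) P := by
  obtain ⟨n, ⟨e⟩⟩ := Finite.exists_equiv_fin ι
  have := (h n (A ∘ e.symm) (fun i => hA _)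
    (fun i j hij => hd (e.symm.injective.ne hij))).precomp e.injective
  simpa [Function.comp_def] using this

lemma comap_apply_le (hN : Measurable N) {A : Set X} (hA : MeasurableSet A) :
    MeasurableSpace.comap (fun ω => (N ω).1 A) inferInstance ≤ mΩ :=
  ((PointMeasure.measurable_apply hA).comp hN).comap_le

/-- The points inside and outside of `L` are independent. -/
lemma HasIndepCounts.indep_iSup [IsProbabilityMeasure P] (h : HasIndepCounts P N)
    (hN : Measurable N) {L : Set X} (hL : MeasurableSet L) {ι κ : Type*}
    {A : ι → Set X} {B : κ → Set X} (hA : ∀ i, MeasurableSet (A i)) (hB : ∀ j, MeasurableSet (B j))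
    (hAL : ∀ i, A i ⊆ L) (hBL : ∀ j, B j ⊆ Lᶜ) :
    Indep (⨆ i, MeasurableSpace.comap (fun ω => (N ω).1 (A i)) inferInstance)
      (⨆ j, MeasurableSpace.comap (fun ω => (N ω).1 (B j)) inferInstance) P := by
  classical
  have key : ∀ (s : Finset ι) (t : Finset κ),
      Indep (⨆ i ∈ s, MeasurableSpace.comap (fun ω => (N ω).1 (A i)) inferInstance)
        (⨆ j ∈ t, MeasurableSpace.comap (fun ω => (N ω).1 (B j)) inferInstance) P := by
    intro s t
    -- The given sets may overlap. The atoms they generate, separately inside `L` and inside `Lᶜ`,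
    -- are disjoint, so their counts are independent.
    let D : Set s ⊕ Set t → Set X := Sum.elim
      (fun σ => L ∩ {x | ∀ i : s, x ∈ A i ↔ i ∈ σ}) (fun τ => Lᶜ ∩ {x | ∀ j : t, x ∈ B j ↔ j ∈ τ})
    have hD : ∀ k, MeasurableSet (D k) := by
      rintro (σ | τ)
      · refine hL.inter ?_
        rw [ofPred_forall]
        exact MeasurableSet.iInter fun i => (hA i).iff (MeasurableSet.const _)
      · refine hL.compl.inter ?_
        rw [ofPred_forall]
        exact MeasurableSet.iInter fun i => (hB i).iff (MeasurableSet.const _)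
    have hd : Pairwise (fun i j => Disjoint (D i) (D j)) := by
      rintro (σ | τ) (σ' | τ') hne <;> rw [Set.disjoint_left]
      · rintro x ⟨-, hx⟩ ⟨-, hx'⟩
        exact hne (congrArg _ (Set.ext fun i => (hx i).symm.trans (hx' i)))
      · rintro x ⟨hx, -⟩ ⟨hx', -⟩
        exact hx' hx
      · rintro x ⟨hx, -⟩ ⟨hx', -⟩
        exact hx hx'
      · rintro x ⟨-, hx⟩ ⟨-, hx'⟩
        exact hne (congrArg _ (Set.ext fun i => (hx i).symm.trans (hx' i)))
    have hind := indep_iSup_of_disjoint (fun k => comap_apply_le hN (hD k))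
      (h.iIndepFun D hD hd).iIndep
      (S := range Sum.inl) (T := range Sum.inr) isCompl_range_inl_range_inr.disjoint
    rw [iSup_range, iSup_range] at hind
    refine indep_of_indep_of_le_left (indep_of_indep_of_le_right hind ?_) ?_
    · refine iSup₂_le fun j hj => comap_apply_le_iSup (fun τ => hD (Sum.inr τ))
        (fun τ τ' hne => hd (Sum.inr_injective.ne hne)) fun x hx => ?_
      refine ⟨{j | x ∈ B j}, ⟨hBL j hx, fun _ => Iff.rfl⟩, fun y hy => ?_⟩
      exact (hy.2 ⟨j, hj⟩).2 hx
    · refine iSup₂_le fun i hi => comap_apply_le_iSup (fun σ => hD (Sum.inl σ))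
        (fun σ σ' hne => hd (Sum.inl_injective.ne hne)) fun x hx => ?_
      refine ⟨{i | x ∈ A i}, ⟨hAL i hx, fun _ => Iff.rfl⟩, fun y hy => ?_⟩
      exact (hy.2 ⟨i, hi⟩).2 hx
  have hle : ∀ s : Finset ι,
      ⨆ i ∈ s, MeasurableSpace.comap (fun ω => (N ω).1 (A i)) inferInstance ≤ mΩ :=
    fun s => iSup₂_le fun i _ => comap_apply_le hN (hA i)
  have hle' : ∀ t : Finset κ,
      ⨆ j ∈ t, MeasurableSpace.comap (fun ω => (N ω).1 (B j)) inferInstance ≤ mΩ :=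
    fun s => iSup₂_le fun i _ => comap_apply_le hN (hB i)
  rw [iSup_eq_iSup_finset, iSup_eq_iSup_finset
    (fun j => MeasurableSpace.comap (fun ω => (N ω).1 (B j)) inferInstance)]
  -- Finite subfamilies are directed, so independence extends to the full suprema, one side at a
  -- time.
  refine indep_iSup_of_directed_le (fun s => ?_) hle (iSup_le hle')
    (Monotone.directed_le fun s t hst => biSup_mono fun i hi => Finset.mem_of_subset hst hi)
  exact (indep_iSup_of_directed_le (fun t => (key s t).symm) hle' (hle s)
    (Monotone.directed_le fun s t hst => biSup_mono fun i hi => Finset.mem_of_subset hst hi)).symm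

end Independence

/-! ### Independence for the compact-indexed filtration -/

section CompactFiltration

variable {Ω X : Type*} [mΩ : MeasurableSpace Ω] [TopologicalSpace X] [T2Space X]
  [MeasurableSpace X] [BorelSpace X] {P : Measure Ω} {N : Ω → PointMeasure X}

lemma setFiltration_le (hN : Measurable N) (K : Compacts X) : setFiltration N K ≤ mΩ :=
  iSup₂_le fun U _ => comap_apply_le hN U.isCompact.measurableSet

lemma PointMeasure.measurable_restrictCompl (K : Compacts X) :
    Measurable (fun m : PointMeasure X => m.restrictCompl K) :=
  measurable_of_apply fun A hA => by
    simp only [restrictCompl_apply _ _ hA]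
    exact measurable_apply (hA.diff K.isCompact.measurableSet)

lemma HasIndepCounts.indep_restrictCompl [IsProbabilityMeasure P] (h : HasIndepCounts P N)
    (hN : Measurable N) (K : Compacts X) :
    Indep (setFiltration N K)
      (MeasurableSpace.comap (fun ω => (N ω).restrictCompl K) inferInstance) P := by
  have := h.indep_iSup hN K.isCompact.measurableSet
    (A := fun U : {U : Compacts X // (U : Set X) ⊆ K} => (U.1 : Set X))
    (B := fun A : {A : Set X // MeasurableSet A} => A.1 \ K)
    (fun U => U.1.isCompact.measurableSet) (fun A => A.2.diff K.isCompact.measurableSet)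
    (fun U => U.2) (fun A => sdiff_subset_compl _ _)
  rw [setFiltration, iSup_subtype']
  refine indep_of_indep_of_le_right this ?_
  rw [← measurable_iff_comap_le]
  refine @PointMeasure.measurable_of_apply _ _ _ (_) _ fun A hA => ?_
  simp only [PointMeasure.restrictCompl_apply _ _ hA]
  exact Measurable.of_comap_le (le_iSup_of_le (⟨A, hA⟩ : {A : Set X // MeasurableSet A}) le_rfl)

end CompactFiltration

/-! ### Outer approximation of compact sets by finite unions of balls -/

section Approximation

variable {X : Type*} [MetricSpace X] [CompactSpace X]

lemma exists_finset_closedBall_cover (X : Type*) [MetricSpace X] [CompactSpace X] (n : ℕ) :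
    ∃ t : Finset X, ∀ y : X, ∃ x ∈ t, y ∈ Metric.closedBall x (1 / (n + 1 : ℝ)) := by
  obtain ⟨t, -, ht, h⟩ := (isCompact_univ (X := X)).finite_cover_balls
    (e := 1 / (n + 1 : ℝ)) (by positivity)
  refine ⟨ht.toFinset, fun y => ?_⟩
  obtain ⟨x, hx, hy⟩ := mem_iUnion₂.1 (h (mem_univ y))
  exact ⟨x, ht.mem_toFinset.2 hx, Metric.ball_subset_closedBall hy⟩

/-- A finite net of mesh `1 / (n + 1)` in a compact metric space. -/
noncomputable def compactNet (X : Type*) [MetricSpace X] [CompactSpace X] (n : ℕ) : Finset X :=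
  (exists_finset_closedBall_cover X n).choose

lemma exists_mem_compactNet (n : ℕ) (y : X) :
    ∃ x ∈ compactNet X n, y ∈ Metric.closedBall x (1 / (n + 1 : ℝ)) :=
  (exists_finset_closedBall_cover X n).choose_spec y

open Classical in
/-- The points of the net of mesh `1 / (n + 1)` that are close to `K`. -/
noncomputable def netHits (n : ℕ) (K : Compacts X) : Finset X :=
  (compactNet X n).filter fun x => ((K : Set X) ∩ Metric.closedBall x (1 / (n + 1 : ℝ))).Nonempty

/-- The union of the closed balls of radius `1 / (n + 1)` around the points of `T`. -/
def ballUnion (n : ℕ) (T : Finset X) : Compacts X where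
  carrier := ⋃ x ∈ T, Metric.closedBall x (1 / (n + 1 : ℝ))
  isCompact' := T.isCompact_biUnion fun _ _ => Metric.isClosed_closedBall.isCompact

lemma mem_ballUnion {n : ℕ} {T : Finset X} {y : X} :
    y ∈ (ballUnion n T : Set X) ↔ ∃ x ∈ T, y ∈ Metric.closedBall x (1 / (n + 1 : ℝ)) := by
  change y ∈ ⋃ x ∈ T, _ ↔ _
  simp only [mem_iUnion, exists_prop]

open Classical in
lemma mem_netHits {n : ℕ} {K : Compacts X} {x : X} :
    x ∈ netHits n K ↔ x ∈ compactNet X n ∧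
      ((K : Set X) ∩ Metric.closedBall x (1 / (n + 1 : ℝ))).Nonempty := by
  rw [netHits, Finset.mem_filter]

lemma subset_ballUnion_netHits (n : ℕ) (K : Compacts X) :
    (K : Set X) ⊆ ballUnion n (netHits n K) := fun y hy => by
  obtain ⟨x, hx, hyx⟩ := exists_mem_compactNet n y
  exact mem_ballUnion.2 ⟨x, mem_netHits.2 ⟨hx, y, hy, hyx⟩, hyx⟩

/-- A point of a hit ball is within `2 / (n + 1)` of `K`, and `K` is closed. -/
lemma eventually_mem_ballUnion_netHits_iff (K : Compacts X) (y : X) :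
    ∀ᶠ n in atTop, y ∈ (ballUnion n (netHits n K) : Set X) ↔ y ∈ (K : Set X) := by
  by_cases hy : y ∈ (K : Set X)
  · exact Eventually.of_forall fun n => iff_of_true (subset_ballUnion_netHits n K hy) hy
  · obtain ⟨r, hr, hball⟩ := Metric.isOpen_iff.1 K.isCompact.isClosed.isOpen_compl y hy
    have h0 : ∀ᶠ n : ℕ in atTop, 1 / (n + 1 : ℝ) < r / 2 :=
      tendsto_one_div_add_atTop_nhds_zero_nat.eventually_lt_const (half_pos hr)
    filter_upwards [h0] with n hn
    refine iff_of_false (fun h => ?_) hy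
    obtain ⟨x, hx, hyx⟩ := mem_ballUnion.1 h
    obtain ⟨z, hzK, hzx⟩ := (mem_netHits.1 hx).2
    refine hball (Metric.mem_ball.2 ?_) hzK
    have := dist_triangle_right z y x
    rw [Metric.mem_closedBall] at hyx hzx
    linarith

/-- The part of the space at distance at least `1 / (m + 1)` from the balls of the net of mesh
`1 / (n + 1)` whose centres are not in `T`. -/
noncomputable def netInner (n m : ℕ) (T : Finset X) : Compacts X where
  carrier := {y | ((m : ℝ≥0∞) + 1)⁻¹ ≤
    Metric.infEDist y (⋃ x ∈ (compactNet X n : Set X) \ T, Metric.closedBall x (1 / (n + 1 : ℝ)))}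
  isCompact' := (isClosed_le continuous_const Metric.continuous_infEDist).isCompact

lemma disjoint_netInner {n m : ℕ} {T : Finset X} {x : X} (hx : x ∈ compactNet X n) (hxT : x ∉ T) :
    Disjoint (netInner n m T : Set X) (Metric.closedBall x (1 / (n + 1 : ℝ))) := by
  rw [Set.disjoint_left]
  intro y hy hyx
  change ((m : ℝ≥0∞) + 1)⁻¹ ≤ _ at hy
  rw [Metric.infEDist_zero_of_mem (mem_biUnion (show x ∈ (compactNet X n : Set X) \ T from
    ⟨hx, hxT⟩) hyx)] at hy
  simp at hy

/-- The net balls cover the space, so a point avoiding every ball centred outside `T` lies in one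
centred in `T`. -/
lemma netInner_subset_ballUnion (n m : ℕ) (T : Finset X) :
    (netInner n m T : Set X) ⊆ ballUnion n T := fun y hy => by
  obtain ⟨x, hx, hyx⟩ := exists_mem_compactNet n y
  by_contra h
  exact Set.disjoint_left.1
    (disjoint_netInner hx fun hxT => h (mem_ballUnion.2 ⟨x, hxT, hyx⟩)) hy hyx

/-- The stopping property only speaks of containment in compact sets, whereas `netHits n K ⊆ T` says
that `K` avoids a finite union of closed balls. Disjoint compact and closed sets are a positive
distance apart, so avoidance is a countable union of containments. -/
lemma netHits_subset_iff {n : ℕ} {T : Finset X} {K : Compacts X} :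
    netHits n K ⊆ T ↔ ∃ m, (K : Set X) ⊆ netInner n m T := by
  refine ⟨fun h => ?_, fun ⟨m, hm⟩ x hx => ?_⟩
  · have hclosed : IsClosed
        (⋃ x ∈ (compactNet X n : Set X) \ T, Metric.closedBall x (1 / (n + 1 : ℝ))) :=
      ((compactNet X n).finite_toSet.sdiff).isClosed_biUnion fun _ _ => Metric.isClosed_closedBall
    have hdisj : Disjoint (K : Set X)
        (⋃ x ∈ (compactNet X n : Set X) \ T, Metric.closedBall x (1 / (n + 1 : ℝ))) := by
      rw [Set.disjoint_left]
      intro y hy hy'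
      obtain ⟨x, hx, hyx⟩ := mem_iUnion₂.1 hy'
      exact hx.2 (h (mem_netHits.2 ⟨hx.1, y, hy, hyx⟩))
    obtain ⟨r, hr, hlt⟩ := Metric.exists_pos_forall_lt_edist K.isCompact hclosed hdisj
    obtain ⟨m, hm⟩ := ENNReal.exists_inv_nat_lt (ENNReal.coe_ne_zero.2 hr.ne')
    refine ⟨m, fun y hy => ?_⟩
    refine le_trans (ENNReal.inv_le_inv.2 le_self_add) (Metric.le_infEDist.2 fun z hz => ?_)
    exact hm.le.trans (hlt y hy z hz).le
  · by_contra hxT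
    obtain ⟨hx, y, hy, hyx⟩ := mem_netHits.1 hx
    exact Set.disjoint_left.1 (disjoint_netInner hx hxT) (hm hy) hyx

open Classical in
-- Expresses an exact value of `netHits` through the monotone events `netHits ⊆ T'`, the only ones
-- directly accessible.
lemma setOf_netHits_eq {α : Type*} (n : ℕ) (T : Finset X) (S : α → Compacts X) :
    {a | netHits n (S a) = T} =
      {a | netHits n (S a) ⊆ T} \ ⋃ T' ∈ T.ssubsets, {a | netHits n (S a) ⊆ T'} := by
  ext a
  simp only [mem_ofPred_eq, Set.mem_sdiff, mem_iUnion, Finset.mem_ssubsets, exists_prop, not_exists,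
    not_and]
  refine ⟨fun h => ⟨h.subset, fun T' hT' h' => hT'.2 (h ▸ h')⟩, fun ⟨h, h'⟩ => ?_⟩
  by_contra hne
  exact h' _ (Finset.ssubset_iff_subset_ne.2 ⟨h, hne⟩) (Finset.Subset.refl _)

open Classical in
/-- If the events `{S ⊆ K}`, intersected with `G`, are measurable for compact `K` inside the balls
around `T`, then so are the events on which `S` hits exactly the balls of the net that have their centres in `T`. -/
lemma measurableSet_inter_netHits_eq {α : Type*} {mα : MeasurableSpace α} {S : α → Compacts X}
    {G : Set α} {n : ℕ} {T : Finset X}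
    (h : ∀ K : Compacts X, (K : Set X) ⊆ ballUnion n T →
      MeasurableSet (G ∩ {a | (S a : Set X) ⊆ K})) :
    MeasurableSet (G ∩ {a | netHits n (S a) = T}) := by
  have hsub : ∀ T' ⊆ T, MeasurableSet (G ∩ {a | netHits n (S a) ⊆ T'}) := fun T' hT' => by
    simp only [netHits_subset_iff, ofPred_exists, inter_iUnion]
    refine MeasurableSet.iUnion fun m => h _ ((netInner_subset_ballUnion n m T').trans ?_)
    exact fun y hy => by
      obtain ⟨x, hx, hyx⟩ := mem_ballUnion.1 hy
      exact mem_ballUnion.2 ⟨x, hT' hx, hyx⟩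
  rw [setOf_netHits_eq, inter_sdiff_distrib_left, inter_iUnion₂]
  refine (hsub T (Finset.Subset.refl T)).diff (Finset.measurableSet_biUnion _ fun T' hT' => ?_)
  exact hsub T' (Finset.mem_ssubsets.1 hT').1

open Classical in
lemma netHits_mem_powerset (n : ℕ) (K : Compacts X) : netHits n K ∈ (compactNet X n).powerset :=
  Finset.mem_powerset.2 (Finset.filter_subset _ _)

end Approximation

lemma measurableSet_netHits_eq {α X : Type*} {mα : MeasurableSpace α} [MetricSpace X]
    [CompactSpace X] {S : α → Compacts X}
    (hS : ∀ K : Compacts X, MeasurableSet {a | (S a : Set X) ⊆ K}) (n : ℕ)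
    (T : Finset X) : MeasurableSet {a | netHits n (S a) = T} := by
  have := measurableSet_inter_netHits_eq (S := S) (G := univ) (n := n) (T := T)
    fun K _ => by simpa using hS K
  simpa using this

/-- Keeping `g` and `h` separate serves both the diagonal, where set and process share one `ω`, and
the product space, where they are independent. -/
lemma preimage_restrictCompl_netHits {Ω α X : Type*} [MetricSpace X] [CompactSpace X]
    [MeasurableSpace X] [BorelSpace X] (N : Ω → PointMeasure X) (S : α → Compacts X) (n : ℕ)
    {β : Type*} (g : β → α) (h : β → Ω) (B : Set (PointMeasure X)) :
    {b | (N (h b)).restrictCompl (ballUnion n (netHits n (S (g b)))) ∈ B} =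
      ⋃ T ∈ (compactNet X n).powerset,
        {b | netHits n (S (g b)) = T} ∩ {b | (N (h b)).restrictCompl (ballUnion n T) ∈ B} := by
  ext b
  simp only [mem_iUnion, mem_inter_iff, mem_ofPred_eq, exists_prop]
  refine ⟨fun hb => ⟨_, netHits_mem_powerset n _, rfl, hb⟩, ?_⟩
  rintro ⟨T, -, rfl, hb⟩
  exact hb

/-! ### Measurability of removing a random compact set -/

section RandomCompact

variable {Ω α X : Type*} [mΩ : MeasurableSpace Ω] {mα : MeasurableSpace α} [MetricSpace X]
  [CompactSpace X] [MeasurableSpace X] [BorelSpace X] {P : Measure Ω} {N : Ω → PointMeasure X}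
  {S : α → Compacts X}

lemma tendsto_restrictCompl_netHits (m : PointMeasure X) (K : Compacts X) {A : Set X}
    (hA : MeasurableSet A) :
    Tendsto (fun n => (m.restrictCompl (ballUnion n (netHits n K))).1 A) atTop
      (𝓝 ((m.restrictCompl K).1 A)) := by
  simp only [PointMeasure.restrictCompl_apply _ _ hA]
  refine tendsto_measure_of_tendsto_indicator_of_isFiniteMeasure _ _
    (fun n => hA.diff (ballUnion n (netHits n K)).isCompact.measurableSet) fun y => ?_
  filter_upwards [eventually_mem_ballUnion_netHits_iff K y] with n hn
  rw [Set.mem_sdiff, Set.mem_sdiff, hn]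

lemma measurable_restrictCompl_netHits (hN : Measurable N)
    (hS : ∀ K : Compacts X, MeasurableSet {a | (S a : Set X) ⊆ K}) (n : ℕ) :
    Measurable fun p : α × Ω => (N p.2).restrictCompl (ballUnion n (netHits n (S p.1))) := by
  intro B hB
  change MeasurableSet {p : α × Ω | _ ∈ B}
  rw [preimage_restrictCompl_netHits N S n Prod.fst Prod.snd]
  refine Finset.measurableSet_biUnion _ fun T _ => ?_
  exact (measurable_fst (measurableSet_netHits_eq hS n T)).inter
    ((((PointMeasure.measurable_restrictCompl _).comp hN).comp measurable_snd) hB)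

/-- Removing the points in a random compact set is measurable, jointly in the compact set and the
point measure. -/
lemma measurable_restrictCompl_prod (hN : Measurable N)
    (hS : ∀ K : Compacts X, MeasurableSet {a | (S a : Set X) ⊆ K}) :
    Measurable fun p : α × Ω => (N p.2).restrictCompl (S p.1) :=
  PointMeasure.measurable_of_apply fun _ hA =>
    measurable_of_tendsto_metrizable
      (fun n => (PointMeasure.measurable_apply hA).comp (measurable_restrictCompl_netHits hN hS n))
      (tendsto_pi_nhds.2 fun p => tendsto_restrictCompl_netHits (N p.2) (S p.1) hA)

end RandomCompact

/-! ### The strong Markov identity -/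

section StrongMarkov

variable {Ω X : Type*} [mΩ : MeasurableSpace Ω] [MetricSpace X]
  [CompactSpace X] [MeasurableSpace X] [BorelSpace X] {P : Measure Ω} [IsProbabilityMeasure P]
  {N : Ω → PointMeasure X} {S : Ω → Compacts X}

lemma HasIndepCounts.measure_inter_netHits (h : HasIndepCounts P N) (hN : Measurable N)
    (hS : ∀ K : Compacts X, MeasurableSet {ω | (S ω : Set X) ⊆ K}) {G : Set Ω}
    (hG : MeasurableSet G)
    (hGS : ∀ K : Compacts X, MeasurableSet[setFiltration N K] (G ∩ {ω | (S ω : Set X) ⊆ K}))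
    (n : ℕ) {B : Set (PointMeasure X)} (hB : MeasurableSet B) :
    P (G ∩ {ω | (N ω).restrictCompl (ballUnion n (netHits n (S ω))) ∈ B}) =
      (P.prod P) {p | p.1 ∈ G ∧
        (N p.2).restrictCompl (ballUnion n (netHits n (S p.1))) ∈ B} := by
  have hBT : ∀ T, MeasurableSet {ω | (N ω).restrictCompl (ballUnion n T) ∈ B} := fun T =>
    ((PointMeasure.measurable_restrictCompl _).comp hN) hB
  have hGT : ∀ T, MeasurableSet (G ∩ {ω | netHits n (S ω) = T}) := fun T =>
    hG.inter (measurableSet_netHits_eq hS n T)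
  have hset : {p : Ω × Ω | p.1 ∈ G ∧
      (N p.2).restrictCompl (ballUnion n (netHits n (S p.1))) ∈ B} =
      ⋃ T ∈ (compactNet X n).powerset, (G ∩ {ω | netHits n (S ω) = T}) ×ˢ
        {ω | (N ω).restrictCompl (ballUnion n T) ∈ B} := by
    have := preimage_restrictCompl_netHits N S n (Prod.fst : Ω × Ω → Ω) Prod.snd B
    rw [show {p : Ω × Ω | p.1 ∈ G ∧ (N p.2).restrictCompl (ballUnion n (netHits n (S p.1))) ∈ B}
      = (Prod.fst ⁻¹' G) ∩ {p | (N p.2).restrictCompl (ballUnion n (netHits n (S p.1))) ∈ B}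
      from rfl, this, inter_iUnion₂]
    refine iUnion₂_congr fun T _ => ?_
    rw [← inter_assoc]
    rfl
  have hset' := preimage_restrictCompl_netHits N S n (id : Ω → Ω) id B
  simp only [id] at hset'
  rw [hset, hset', inter_iUnion₂, measure_biUnion_finset, measure_biUnion_finset]
  · refine Finset.sum_congr rfl fun T _ => ?_
    rw [Measure.prod_prod, ← inter_assoc]
    refine (Indep_iff _ _ P).1 (h.indep_restrictCompl hN (ballUnion n T)) _ _ ?_ ⟨B, hB, rfl⟩
    -- Only compacts inside `ballUnion n T` are tested, so every event involved lies in the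
    -- σ-algebra of that set.
    refine @measurableSet_inter_netHits_eq _ _ _ _ (setFiltration N (ballUnion n T)) _ _ _ _
      fun K hK => setFiltration_mono N hK _ (hGS K)
  · intro T _ T' _ hne
    refine Set.disjoint_left.2 fun p hp hp' => hne ?_
    exact hp.1.2.symm.trans hp'.1.2
  · exact fun T _ => (hGT T).prod (hBT T)
  · intro T _ T' _ hne
    refine Set.disjoint_left.2 fun ω hω hω' => hne ?_
    exact hω.2.1.symm.trans hω'.2.1
  · intro T _
    rw [← inter_assoc]
    exact (hGT T).inter (hBT T)

/-- On an event in the history of `S`, the process outside of `S` is distributed like an independent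
copy of the process, outside of `S`. -/
lemma HasIndepCounts.measure_inter_restrictCompl (h : HasIndepCounts P N) (hN : Measurable N)
    (hS : ∀ K : Compacts X, MeasurableSet {ω | (S ω : Set X) ⊆ K}) {G : Set Ω}
    (hG : MeasurableSet G)
    (hGS : ∀ K : Compacts X, MeasurableSet[setFiltration N K] (G ∩ {ω | (S ω : Set X) ⊆ K}))
    {B : Set (PointMeasure X)} (hB : MeasurableSet B) :
    P (G ∩ {ω | (N ω).restrictCompl (S ω) ∈ B}) =
      (P.prod P) {p | p.1 ∈ G ∧ (N p.2).restrictCompl (S p.1) ∈ B} := by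
  have hf := measurable_restrictCompl_prod hN hS
  have hdiag : Measurable fun ω : Ω => (ω, ω) := measurable_id.prodMk measurable_id
  have hfd : Measurable fun ω => (N ω).restrictCompl (S ω) := hf.comp hdiag
  have hG2 : MeasurableSet (Prod.fst ⁻¹' G : Set (Ω × Ω)) := measurable_fst hG
  -- Cylinders come first because the indicators converge pointwise for them; for general `B` they
  -- need not.
  have hcyl : ∀ B ∈ PointMeasure.cylinders X,
      P (G ∩ {ω | (N ω).restrictCompl (S ω) ∈ B}) =
        (P.prod P) {p | p.1 ∈ G ∧ (N p.2).restrictCompl (S p.1) ∈ B} := by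
    intro B hBc
    have hB : MeasurableSet B := by
      rw [PointMeasure.generateFrom_cylinders]
      exact MeasurableSpace.measurableSet_generateFrom hBc
    have h1 : Tendsto
        (fun n => P (G ∩ {ω | (N ω).restrictCompl (ballUnion n (netHits n (S ω))) ∈ B})) atTop
        (𝓝 (P (G ∩ {ω | (N ω).restrictCompl (S ω) ∈ B}))) := by
      refine tendsto_measure_of_tendsto_indicator_of_isFiniteMeasure _ _
        (fun n => hG.inter (((measurable_restrictCompl_netHits hN hS n).comp hdiag) hB)) fun ω => ?_
      filter_upwards [PointMeasure.eventually_mem_cylinder_iff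
        (fun A hA => tendsto_restrictCompl_netHits (N ω) (S ω) hA) hBc] with n hn
      exact and_congr_right fun _ => hn
    have h2 : Tendsto
        (fun n => (P.prod P) {p | p.1 ∈ G ∧
          (N p.2).restrictCompl (ballUnion n (netHits n (S p.1))) ∈ B}) atTop
        (𝓝 ((P.prod P) {p | p.1 ∈ G ∧ (N p.2).restrictCompl (S p.1) ∈ B})) := by
      refine tendsto_measure_of_tendsto_indicator_of_isFiniteMeasure _ _
        (fun n => hG2.inter ((measurable_restrictCompl_netHits hN hS n) hB)) fun p => ?_
      filter_upwards [PointMeasure.eventually_mem_cylinder_iff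
        (fun A hA => tendsto_restrictCompl_netHits (N p.2) (S p.1) hA) hBc] with n hn
      exact and_congr_right fun _ => hn
    simp only [h.measure_inter_netHits hN hS hG hGS _ hB] at h1
    exact tendsto_nhds_unique h1 h2
  have hmap : ∀ B, MeasurableSet B → ((P.restrict G).map fun ω => (N ω).restrictCompl (S ω)) B =
      P (G ∩ {ω | (N ω).restrictCompl (S ω) ∈ B}) := fun B hB => by
    rw [Measure.map_apply hfd hB, Measure.restrict_apply (hfd hB), inter_comm]
    rfl
  have hmap2 : ∀ B, MeasurableSet B → (((P.prod P).restrict (Prod.fst ⁻¹' G)).map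
      fun p : Ω × Ω => (N p.2).restrictCompl (S p.1)) B =
      (P.prod P) {p | p.1 ∈ G ∧ (N p.2).restrictCompl (S p.1) ∈ B} := fun B hB => by
    rw [Measure.map_apply hf hB, Measure.restrict_apply (hf hB), inter_comm]
    rfl
  rw [← hmap B hB, ← hmap2 B hB]
  congr 1
  refine ext_of_generate_finite _ PointMeasure.generateFrom_cylinders
    PointMeasure.isPiSystem_cylinders (fun B hBc => ?_) ?_
  · have hB : MeasurableSet B := by
      rw [PointMeasure.generateFrom_cylinders]
      exact MeasurableSpace.measurableSet_generateFrom hBc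
    rw [hmap B hB, hmap2 B hB, hcyl B hBc]
  · rw [hmap _ MeasurableSet.univ, hmap2 _ MeasurableSet.univ,
      show {p : Ω × Ω | p.1 ∈ G ∧ (N p.2).restrictCompl (S p.1) ∈ univ} = G ×ˢ univ from rfl,
      Measure.prod_prod]
    simp

end StrongMarkov

/-! ### From the product identity to a regular conditional distribution -/

section CondDistrib

variable {Ω α β : Type*} [mΩ : MeasurableSpace Ω] [mα : MeasurableSpace α]
  [mβ : MeasurableSpace β] {P : Measure Ω} [IsProbabilityMeasure P]

/-- The kernel `a ↦ law of f (a, ·)`. -/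
noncomputable def lawKernel (P : Measure Ω) [IsProbabilityMeasure P] (f : α × Ω → β) :
    Kernel α β :=
  (Kernel.id ×ₖ Kernel.const α P).map f

lemma lawKernel_apply {f : α × Ω → β} (hf : Measurable f) (a : α) :
    lawKernel P f a = P.map fun ω => f (a, ω) := by
  rw [lawKernel, Kernel.map_apply _ hf, Kernel.prod_apply, Kernel.id_apply, Kernel.const_apply,
    Measure.dirac_prod, Measure.map_map hf measurable_prodMk_left]
  rfl

lemma isMarkovKernel_lawKernel {f : α × Ω → β} (hf : Measurable f) :
    IsMarkovKernel (lawKernel P f) :=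
  Kernel.IsMarkovKernel.map _ hf

/-- The hypothesis says that `Y`, jointly with `Z`, behaves like `f` evaluated at `Z` and an
independent sample. Fubini turns this into equality of the joint laws on rectangles, which determine
them. -/
lemma hasCondDistrib_lawKernel {f : α × Ω → β} (hf : Measurable f) {Z : Ω → α} (hZ : Measurable Z)
    {Y : Ω → β} (hY : Measurable Y)
    (h : ∀ G B, MeasurableSet G → MeasurableSet B →
      P (Z ⁻¹' G ∩ Y ⁻¹' B) = (P.prod P) {p | Z p.1 ∈ G ∧ f (Z p.1, p.2) ∈ B}) :
    HasCondDistrib Y Z (lawKernel P f) P := by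
  have := isMarkovKernel_lawKernel (P := P) hf
  have := Measure.isProbabilityMeasure_map (μ := P) hZ.aemeasurable
  refine ⟨(hZ.prodMk hY).aemeasurable, ?_⟩
  have := Measure.isProbabilityMeasure_map (μ := P) (hZ.prodMk hY).aemeasurable
  refine Measure.ext_prod fun {G B} hG hB => ?_
  have hfZ : Measurable fun p : Ω × Ω => f (Z p.1, p.2) :=
    hf.comp ((hZ.comp measurable_fst).prodMk measurable_snd)
  rw [Measure.map_apply (hZ.prodMk hY) (hG.prod hB), Measure.compProd_apply_prod hG hB,
    setLIntegral_map hG (Kernel.measurable_coe _ hB) hZ, mk_preimage_prod, h G B hG hB,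
    Measure.prod_apply (s := {p | Z p.1 ∈ G ∧ f (Z p.1, p.2) ∈ B})
      ((hZ.comp measurable_fst hG).inter (hfZ hB)),
    ← lintegral_indicator (hZ hG)]
  refine lintegral_congr fun ω => ?_
  by_cases hω : Z ω ∈ G
  · rw [indicator_of_mem (by exact hω), lawKernel_apply hf,
      Measure.map_apply (f := fun ω' => f (Z ω, ω')) (hf.comp measurable_prodMk_left) hB]
    congr 1
    ext ω'
    simp [hω]
  · rw [indicator_of_notMem (by exact hω)]
    convert measure_empty (μ := P)
    ext ω'
    simp [hω]

lemma HasCondDistrib.measure_inter {Y : Ω → β} {Z : Ω → α} (hZ : Measurable Z) (hY : Measurable Y)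
    {κ : Kernel α β} [IsMarkovKernel κ] (h : HasCondDistrib Y Z κ P) {G : Set α} {B : Set β}
    (hG : MeasurableSet G) (hB : MeasurableSet B) :
    P (Z ⁻¹' G ∩ Y ⁻¹' B) = ∫⁻ ω in Z ⁻¹' G, κ (Z ω) B ∂P := by
  have := Measure.isProbabilityMeasure_map (μ := P) hZ.aemeasurable
  have hrect := DFunLike.congr_fun h.map_eq (G ×ˢ B)
  rwa [Measure.map_apply (hZ.prodMk hY) (hG.prod hB), Measure.compProd_apply_prod hG hB,
    setLIntegral_map hG (Kernel.measurable_coe _ hB) hZ, mk_preimage_prod] at hrect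

lemma HasCondDistrib.condExp_ae_eq {Ω : Type*} {m : MeasurableSpace Ω} [mΩ : MeasurableSpace Ω]
    {P : Measure Ω} [IsProbabilityMeasure P] (hm : m ≤ mΩ) {Y : Ω → β}
    (hY : Measurable Y) {κ : @Kernel Ω β m _} (hκ : IsMarkovKernel κ)
    (h : HasCondDistrib (m𝓧 := m) Y id κ P) {B : Set β} (hB : MeasurableSet B) :
    P⟦Y ⁻¹' B | m⟧ =ᵐ[P] fun ω => (κ ω).real B := by
  have hid : @Measurable Ω Ω mΩ m id := measurable_id'' hm
  have hκB : Measurable[m] fun ω => (κ ω).real B := (Kernel.measurable_coe κ hB).ennreal_toReal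
  have hint : Integrable (fun ω => (κ ω).real B) P :=
    Integrable.of_bound (hκB.mono hm le_rfl).aestronglyMeasurable 1 (ae_of_all _ fun ω => by
      rw [Real.norm_of_nonneg measureReal_nonneg]
      exact measureReal_le_one)
  symm
  refine ae_eq_condExp_of_forall_setIntegral_eq hm
    ((integrable_const (1 : ℝ)).indicator (hY hB)) (fun _ _ _ => hint.integrableOn) ?_
    hκB.aestronglyMeasurable
  intro G hG _
  have hrect := HasCondDistrib.measure_inter (mα := m) hid hY h hG hB
  rw [setIntegral_indicator (hY hB), setIntegral_const, smul_eq_mul, mul_one,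
    integral_eq_lintegral_of_nonneg_ae (ae_of_all _ fun _ => measureReal_nonneg)
      hint.aestronglyMeasurable.restrict, measureReal_def]
  congr 1
  refine Eq.trans (lintegral_congr fun ω => ?_) hrect.symm
  exact ENNReal.ofReal_toReal (measure_ne_top _ _)

end CondDistrib

/-! ### The history, the Poisson law, and the conclusion -/

/-- Being contained in `K` and in `L` is being contained in `K ⊓ L`. This is what makes the
conditional kernel measurable with respect to the history, not merely the ambient σ-algebra. -/
lemma IsStoppingSet.measurableSet_history_subset {Ω X : Type*} [TopologicalSpace X] [T2Space X]
    [MeasurableSpace X] {N : Ω → PointMeasure X} {𝒦 : PointMeasure X → Compacts X}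
    (h : IsStoppingSet N 𝒦) (K : Compacts X) :
    MeasurableSet[h.history] {ω | (𝒦 (N ω) : Set X) ⊆ K} := by
  refine ⟨le_iSup (setFiltration N) K _ (h.measurableSet_subset K), fun L => ?_⟩
  have hKL : {ω | (𝒦 (N ω) : Set X) ⊆ K} ∩ {ω | (𝒦 (N ω) : Set X) ⊆ L} =
      {ω | (𝒦 (N ω) : Set X) ⊆ (K ⊓ L : Compacts X)} := by
    ext ω
    simp [subset_inter_iff]
  rw [hKL]
  exact setFiltration_mono N (K := K ⊓ L) (by simp) _ (h.measurableSet_subset _)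

section History

variable {Ω X : Type*} [mΩ : MeasurableSpace Ω] [TopologicalSpace X] [T2Space X]
  [MeasurableSpace X] [BorelSpace X] {N : Ω → PointMeasure X} {𝒦 : PointMeasure X → Compacts X}

lemma IsStoppingSet.history_le (h : IsStoppingSet N 𝒦) (hN : Measurable N) : h.history ≤ mΩ :=
  fun A hA => iSup_le (setFiltration_le hN) A hA.1

end History

/-- For a deterministic `K`, the new count in `A` is the old count in `A \ K`, and removing `K`
preserves disjointness. -/
lemma IsPoissonPointProcess.map_restrictCompl {d : ℕ} {E : Set (EuclideanSpace ℝ (Fin d))}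
    {Ω : Type*} [MeasurableSpace Ω] {P : Measure Ω} {N : Ω → PointMeasure E} {lam : ℝ≥0}
    {C : Set E} (hN : IsPoissonPointProcess P N lam C) (K : Compacts E) :
    IsPoissonPointProcess (P.map fun ω => (N ω).restrictCompl K) id lam (C \ K) := by
  have hK : MeasurableSet (K : Set E) := K.isCompact.measurableSet
  have hm : Measurable fun ω => (N ω).restrictCompl K :=
    (PointMeasure.measurable_restrictCompl K).comp hN.measurable
  refine ⟨measurable_id, fun A hA => ?_, fun n A hA hd => ?_⟩
  · have hlaw := hN.law (A \ K) (hA.diff hK)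
    refine ⟨(PointMeasure.measurable_apply hA).aemeasurable, ?_⟩
    change Measure.map (fun m : PointMeasure E => m.1 A) _ = _
    rw [Measure.map_map (PointMeasure.measurable_apply hA) hm,
      show A ∩ (C \ K) = (A \ K) ∩ C by ext; simp; tauto, ← hlaw.map_eq]
    congr 1
    ext ω
    exact PointMeasure.restrictCompl_apply _ _ hA
  · have hind : iIndepFun (fun i => (fun m : PointMeasure E => m.1 (A i \ K)) ∘ N) P :=
      hN.indep n (fun i => A i \ K) (fun i => (hA i).diff hK)
        fun i j hij => (hd hij).mono sdiff_subset sdiff_subset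
    have := hind.isProbabilityMeasure
    have := Measure.isProbabilityMeasure_map (μ := P) hm.aemeasurable
    change iIndepFun (fun i (m : PointMeasure E) => m.1 (A i)) _
    rw [iIndepFun_iff_map_fun_eq_pi_map
      fun i => (PointMeasure.measurable_apply (hA i)).aemeasurable]
    rw [iIndepFun_iff_map_fun_eq_pi_map fun i =>
      ((PointMeasure.measurable_apply ((hA i).diff hK)).comp hN.measurable).aemeasurable] at hind
    rw [Measure.map_map (measurable_pi_lambda _ fun i => PointMeasure.measurable_apply (hA i)) hm]
    simp only [Function.comp_def,
      Measure.map_map (PointMeasure.measurable_apply (hA _)) hm,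
      PointMeasure.restrictCompl_apply _ _ (hA _)]
    exact hind

theorem mainTheorem10 {d : ℕ} (E : Set (EuclideanSpace ℝ (Fin d)))
    (hE_compact : IsCompact E) (hE_convex : Convex ℝ E) (hE_int : (interior E).Nonempty)
    (C : Set E) (hC_closed : IsClosed C)
    (hC_convex : Convex ℝ ((fun x : E => (x : EuclideanSpace ℝ (Fin d))) '' C))
    (lam : ℝ≥0) (hlam : 0 < lam)
    {Ω : Type*} [mΩ : MeasurableSpace Ω] (P : Measure Ω) [IsProbabilityMeasure P]
    (N : Ω → PointMeasure E) (hN : IsPoissonPointProcess P N lam C)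
    (𝒦 : PointMeasure E → Compacts E) (h𝒦 : IsStoppingSet N 𝒦) :
    -- the process `A ↦ N (A \ 𝒦)` is a random point measure
    Measurable (fun ω => (N ω).restrictCompl (𝒦 (N ω))) ∧
    -- its regular conditional law given the history is that of a Poisson process on `C \ 𝒦`
    (∃ κ : @Kernel Ω (PointMeasure E) h𝒦.history _,
      IsMarkovKernel κ ∧
      HasCondDistrib (m𝓧 := h𝒦.history) (fun ω => (N ω).restrictCompl (𝒦 (N ω))) id κ P ∧
      ∀ ω, IsPoissonPointProcess (κ ω) id lam (C \ (𝒦 (N ω) : Set E))) ∧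
    -- in particular each `N (K \ 𝒦)` is conditionally Poisson
    ∀ (K : Compacts E) (n : ℕ),
      P⟦{ω | (N ω).1 ((K : Set E) \ (𝒦 (N ω) : Set E)) = n} | h𝒦.history⟧ =ᵐ[P]
        fun ω => (poissonMeasure (lam *
          (lebesgueOn E (((K : Set E) ∩ C) \ (𝒦 (N ω) : Set E))).toNNReal)).real {(n : ℕ)} := by
  have : CompactSpace E := isCompact_iff_compactSpace.1 hE_compact
  have hle : h𝒦.history ≤ mΩ := h𝒦.history_le hN.measurable
  -- Conditioning on a σ-algebra is conditioning on the identity map into `Ω` equipped with that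
  -- σ-algebra.
  have hid : @Measurable Ω Ω mΩ h𝒦.history id := measurable_id'' hle
  have hS := h𝒦.measurableSet_history_subset
  have hY : Measurable fun ω => (N ω).restrictCompl (𝒦 (N ω)) :=
    (measurable_restrictCompl_prod (S := fun ω => 𝒦 (N ω)) hN.measurable
      fun K => hle _ (hS K)).comp (measurable_id.prodMk measurable_id)
  have hf := measurable_restrictCompl_prod (mα := h𝒦.history) (S := fun ω => 𝒦 (N ω))
    hN.measurable hS
  have hcounts : HasIndepCounts P N := hN.indep
  have hκ := isMarkovKernel_lawKernel (mα := h𝒦.history) (P := P) hf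
  have hcond := hasCondDistrib_lawKernel (mα := h𝒦.history) (P := P) hf hid hY fun G B hG hB =>
    hcounts.measure_inter_restrictCompl (S := fun ω => 𝒦 (N ω)) hN.measurable
      (fun K => hle _ (hS K)) (hle _ hG) hG.2 hB
  have hPoisson : ∀ ω, IsPoissonPointProcess
      (lawKernel (mα := h𝒦.history) P
        (fun p : Ω × Ω => (N p.2).restrictCompl (𝒦 (N p.1))) ω) id lam
      (C \ (𝒦 (N ω) : Set E)) := fun ω => by
    rw [lawKernel_apply (mα := h𝒦.history) hf]
    exact hN.map_restrictCompl (𝒦 (N ω))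
  refine ⟨hY, ⟨_, hκ, hcond, hPoisson⟩, fun K n => ?_⟩
  have hK : MeasurableSet (K : Set E) := K.isCompact.measurableSet
  have hB : MeasurableSet {m : PointMeasure E | m.1 K = n} :=
    PointMeasure.measurable_apply hK (measurableSet_singleton _)
  have hpre : {ω | (N ω).1 ((K : Set E) \ (𝒦 (N ω) : Set E)) = n} =
      (fun ω => (N ω).restrictCompl (𝒦 (N ω))) ⁻¹' {m : PointMeasure E | m.1 K = n} := by
    ext ω
    rw [mem_preimage, mem_ofPred_eq, mem_ofPred_eq, PointMeasure.restrictCompl_apply _ _ hK]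
  rw [hpre]
  refine (HasCondDistrib.condExp_ae_eq hle hY hκ hcond hB).trans (ae_of_all _ fun ω => ?_)
  have hlaw := (hPoisson ω).law K hK
  have hcast : Measurable (Nat.cast : ℕ → ℝ≥0∞) := measurable_of_countable _
  have heq := congrArg (fun ν => ν {(n : ℝ≥0∞)}) hlaw.map_eq
  simp only [id] at heq
  rw [Measure.map_apply (PointMeasure.measurable_apply hK) (measurableSet_singleton _),
    Measure.map_apply hcast (measurableSet_singleton _),
    show (Nat.cast : ℕ → ℝ≥0∞) ⁻¹' {(n : ℝ≥0∞)} = {n} by ext; simp,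
    ← inter_sdiff_assoc] at heq
  exact congrArg ENNReal.toReal heq
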